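/- For a set $A\subseteq\mathbb R$ and an integer $h\ge1$ let $hA$ be the set of all sums of exactly $h$ elements of $A$ (repetitions allowed), let $\mathcal S(A)=\bigcup_{h\ge1}hA$, and let $G(A)=\sup\{u\in\mathbb R: u\notin\mathcal S(A)\}$. Write $\lfloor x\rfloor$ and $\{x\}=x-\lfloor x\rfloor$ for the integer and fractional parts of $x$. (i) Let $A\subseteq(0,1)$ be an open set of Lebesgue measure $\alpha\in(0,1]$. Then $\{u\in\mathbb R: u\notin\mathcal S(A)\}$ has a largest element, which is therefore $G(A)$, and $$G(A)\le\begin{cases}(1-\alpha)\lfloor 1/\alpha\rfloor & \text{if } 0<\alpha\le 0.1,\\ (1-\alpha+\alpha\{1/\alpha\})\lfloor 1/\alpha\rfloor & \text{if } 0.1\le\alpha\le 0.5,\\ 2(1-\alpha) & \text{if } 0.5\le\alpha\le 1.\end{cases}$$ (ii) For every $\alpha\in(0,1]$ the interval $A=(1-\alpha,1)$ is an open subset of $(0,1)$ of measure $\alpha$ with $G(A)=(1-\alpha)\lfloor 1/\alpha\rfloor$. In particular, the first bound in (i) is attained for every $\alpha\in(0,0.1]$. (iii) For every $\alpha\in[0.5,1]$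 the set $A=(1-\alpha,1)\setminus\{2(1-\alpha)\}$ is an open subset of $(0,1)$ of measure $\alpha$ with $G(A)=2(1-\alpha)$. Thus the third bound in (i) is attained for every $\alpha\in[0.5,1]$. -/

import Mathlib

open MeasureTheory

/-- `kFoldSum h A` is the set `hA` of all sums of exactly `h` elements of `A`
(repetitions allowed). -/
def kFoldSum (h : ℕ) (A : Set ℝ) : Set ℝ :=
  {u | ∃ a : Fin h → ℝ, (∀ i, a i ∈ A) ∧ ∑ i, a i = u}

/-- The semigroup `𝒮(A) = ⋃_{h ≥ 1} hA` additively generated by `A`: all sums of finitely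
many, but at least one, elements of `A`. -/
def sumSemigroup (A : Set ℝ) : Set ℝ :=
  ⋃ h ∈ Set.Ici (1 : ℕ), kFoldSum h A

/-- `G(A) = sup {u ∈ ℝ : u ∉ 𝒮(A)}`. The real supremum has a junk value if the set is not
bounded above, so that assertions about it should come with the boundedness of the set. -/
noncomputable def frobeniusG (A : Set ℝ) : ℝ :=
  sSup {u : ℝ | u ∉ sumSemigroup A}

/-!
Let `S` be the semigroup generated by the open set `A`. It is open, so it is closed under the
addition of every `l` in its closure (`add_mem_of_mem_closure`): each such `l` is a period, and
the part of `S` in the window `(y - l, y)` can be viewed modulo `l`. By Raikov's theorem on the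
circle (`min_le_volume_of_add_mem`), the measure of this window is a superadditive function of
`y`, as long as a number `u ∉ S` keeps the sumsets from filling the circle (`mass_window_add_le`).

*The second and third bounds.* With the period `l = sup (S ∩ (0, 1)) ≤ 1`, the `j`-th window
contains at least `j α` of `S`. If `u ∉ S`, then `x ↦ u - x` maps `S` to its complement, so `S`
fills at most half of `(0, u)`. Together this gives `u ≤ K (2 - α (K + 1))` for some integer `K`
(`exists_le_nat_mul_sub`), and `K` equal to the integer part of `1 / α` is the worst case.

*The first bound.* The main case is `sup A = 1`; the other ones follow by rescaling, or from the
bound just found. Let `k` be the integer part of `1 / α`, so `k ≥ 10`, and suppose that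
`u > k (1 - α)` is not in `S`.

* Modulo `1`, the `k`-th window has measure less than `(k + 1) α`, hence by superadditivity
  `S ∩ (1, 2)` has measure less than `2.2 α`.
* If `l ≤ 1 / 2` is an element of `S`, then two windows of length `l` fit into a window of length
  `1`, and both grow at the rate of `S ∩ (1 - l, 1)`, which therefore is small
  (`mass_near_one_lt`).
* The gap bound for `S ∩ (0, c)` shows that its measure is at most about `c ^ 2 α` (`mass_le_sq`).
* By the last two points, `S` has no elements in `[0.45, 0.5]`, so `S ∩ (1 / 2, 1)` has measure at
  least `0.75 α`. Its doubling is contained in `S ∩ (1, 2)`, and so small that Freiman's theorem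
  on the line (`mass_add_min_le_mass_two_mul`) puts it into an interval `(1 - x, 1)` with
  `x < 1.5 α`.
* A smaller element of `S` would have a multiple `l` between `x` and `1 / 2`, against the second
  point. So the elements of `S` below `1` lie in `(1 - x, 1)` and are dense there, whence the sums
  of `k` or `k + 1` of them cover `u` (`nat_sub_mem_of_dense`).
-/

/-! ### Sumsets in a circle -/

/-- The `i`-th of the open cells of length `η`. -/
def openCell (η : ℝ) (i : ℕ) : Set ℝ := Set.Ioo (i * η) ((i + 1) * η)

lemma volume_real_openCell {η : ℝ} (hη : 0 ≤ η) (i : ℕ) : volume.real (openCell η i) = η := by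
  rw [openCell, Real.volume_real_Ioo_of_le (by nlinarith)]; ring

/-- An open subset of `(0, l)` is exhausted, up to measure `ε`, by the cells of length `l / p` that
it contains, once `p` is large. -/
lemma exists_volume_sub_le_card_openCell {X : Set ℝ} {l ε : ℝ} (hl : 0 < l) (hX : IsOpen X)
    (hXl : X ⊆ Set.Ioo 0 l) (hε : 0 < ε) :
    ∃ P : ℕ, ∀ p : ℕ, P ≤ p → ∀ _ : NeZero p, ∀ T : Finset (ZMod p),
      (∀ i : ZMod p, i ∈ T ↔ openCell (l / p) i.val ⊆ X) →
        volume.real X - ε ≤ T.card * (l / p) := by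
  by_cases h0 : volume.real X - ε < 0
  · refine ⟨0, fun p _ _ T _ => h0.le.trans (by positivity)⟩
  push Not at h0
  have hfin : volume X ≠ ⊤ := ne_top_of_le_ne_top (by simp) (measure_mono hXl)
  obtain ⟨K, hKX, hK, hKr⟩ := hX.exists_lt_isCompact (μ := volume)
    (r := ENNReal.ofReal (volume.real X - ε)) (by
      rw [ENNReal.ofReal_lt_iff_lt_toReal h0 hfin]
      change _ < volume.real X
      linarith)
  obtain ⟨δ, hδ, hthick⟩ := hK.exists_thickening_subset_open hX hKX
  obtain ⟨P, hP⟩ := exists_nat_gt (l / δ)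
  refine ⟨P, fun p hp _ T hT => ?_⟩
  have hp0 : (0 : ℝ) < p := by
    have := NeZero.pos p
    exact_mod_cast this
  have hη : 0 < l / p := by positivity
  have hηδ : l / p < δ := by
    rw [div_lt_iff₀ hp0]
    rw [div_lt_iff₀ hδ] at hP
    have : (P : ℝ) ≤ p := by exact_mod_cast hp
    nlinarith
  have hcov : K ⊆ ⋃ i ∈ T, Set.Icc ((i.val : ℝ) * (l / p)) ((i.val + 1) * (l / p)) := by
    intro x hx
    have hxl := hXl (hKX hx)
    have hn1 := Nat.floor_le (a := x / (l / p)) (by have := hxl.1; positivity)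
    have hn2 := Nat.lt_floor_add_one (x / (l / p))
    set n := ⌊x / (l / p)⌋₊ with hn
    rw [le_div_iff₀ hη] at hn1
    rw [div_lt_iff₀ hη] at hn2
    have hnp : n < p := by
      have : (n : ℝ) * (l / p) < p * (l / p) := by
        rw [mul_div_cancel₀ l hp0.ne']; linarith [hxl.2]
      exact_mod_cast lt_of_mul_lt_mul_right this hη.le
    have hval : ((n : ZMod p)).val = n := ZMod.val_cast_of_lt hnp
    refine Set.mem_biUnion (x := (n : ZMod p)) ?_ ?_
    · rw [Finset.mem_coe, hT, hval]
      intro y hy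
      refine hthick (Metric.mem_thickening_iff.2 ⟨x, hx, ?_⟩)
      rw [Real.dist_eq, abs_lt]
      have h1 := hy.1
      have h2 := hy.2
      constructor <;> nlinarith
    · rw [hval]
      exact ⟨hn1, hn2.le⟩
  have h1 : volume.real X - ε ≤ volume.real K := by
    have : ENNReal.ofReal (volume.real X - ε) ≤ ENNReal.ofReal (volume.real K) := by
      rw [ofReal_measureReal hK.measure_lt_top.ne]; exact hKr.le
    exact (ENNReal.ofReal_le_ofReal_iff (by positivity)).1 this
  refine h1.trans ((measureReal_mono hcov ?_).trans ((measureReal_biUnion_finset_le _ _).trans ?_))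
  · exact (T.isCompact_biUnion fun i _ => isCompact_Icc).measure_lt_top.ne
  · rw [Finset.sum_congr rfl (g := fun _ => l / p)]
    · simp
    · intro i _
      rw [Real.volume_real_Icc_of_le (by nlinarith)]; ring

/-- If the cells `i` and `j` lie in `X` and `Y`, then the cell `i + j` modulo `p` lies in the sumset
modulo `l`. -/
lemma openCell_add_subset {X Y Z : Set ℝ} {l : ℝ} (hl : 0 < l)
    (h1 : ∀ x ∈ X, ∀ y ∈ Y, x + y < l → x + y ∈ Z)
    (h2 : ∀ x ∈ X, ∀ y ∈ Y, l < x + y → x + y - l ∈ Z) {p : ℕ} [NeZero p] {i j : ZMod p}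
    (hi : openCell (l / p) i.val ⊆ X) (hj : openCell (l / p) j.val ⊆ Y) :
    openCell (l / p) (i + j).val ⊆ Z := by
  have hp0 : (0 : ℝ) < p := by
    have := NeZero.pos p
    exact_mod_cast this
  set η := l / p with hη
  have hη0 : 0 < η := by positivity
  have hpη : p * η = l := by rw [hη]; field_simp
  -- every point of the lower half of the sum of two cells is a sum of points of the cells
  have key : ∀ w : ℝ, (i.val + j.val : ℝ) * η < w → w < (i.val + j.val + 1) * η →
      ∃ x ∈ X, ∃ y ∈ Y, x + y = w := by
    intro w hw1 hw2
    refine ⟨i.val * η + (w - (i.val + j.val) * η) / 2, hi ⟨?_, ?_⟩,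
      j.val * η + (w - (i.val + j.val) * η) / 2, hj ⟨?_, ?_⟩, ?_⟩ <;> nlinarith
  intro w hw
  have hw1 := hw.1
  have hw2 := hw.2
  by_cases hij : i.val + j.val < p
  · rw [ZMod.val_add_of_lt hij] at hw1 hw2
    push_cast at hw1 hw2
    obtain ⟨x, hx, y, hy, rfl⟩ := key w hw1 hw2
    refine h1 x hx y hy (hw2.trans_le ?_)
    rw [← hpη]
    have : (i.val + j.val + 1 : ℝ) ≤ p := by exact_mod_cast hij
    gcongr
  · push Not at hij
    have hv := ZMod.val_add_val_of_le hij
    have hv' : (i.val + j.val : ℝ) = (i + j).val + p := by exact_mod_cast hv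
    obtain ⟨x, hx, y, hy, hxy⟩ := key (w + l) (by rw [hv']; nlinarith) (by rw [hv']; nlinarith)
    have := h2 x hx y hy (by
      rw [hxy]
      have : 0 ≤ ((i + j).val : ℝ) * η := by positivity
      linarith)
    rwa [hxy, add_sub_cancel_right] at this

open scoped Pointwise in
/-- **Raikov's theorem** for open sets: the sumset of two nonempty open subsets of the circle
`ℝ / lℤ` has measure at least the sum of their measures, unless it has full measure. The circle is
cut open to the interval `(0, l)`, and `Z` plays the role of the sumset. It follows from the
Cauchy-Davenport theorem for the cells of length `l / p`, with a large prime `p`. -/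
theorem min_le_volume_of_add_mem {X Y Z : Set ℝ} {l : ℝ} (hl : 0 < l) (hX : IsOpen X)
    (hY : IsOpen Y) (hXl : X ⊆ Set.Ioo 0 l) (hYl : Y ⊆ Set.Ioo 0 l) (hZl : Z ⊆ Set.Ioo 0 l)
    (hXne : X.Nonempty) (hYne : Y.Nonempty)
    (h1 : ∀ x ∈ X, ∀ y ∈ Y, x + y < l → x + y ∈ Z)
    (h2 : ∀ x ∈ X, ∀ y ∈ Y, l < x + y → x + y - l ∈ Z) :
    min l (volume.real X + volume.real Y) ≤ volume.real Z := by
  classical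
  have hfin : ∀ W : Set ℝ, W ⊆ Set.Ioo 0 l → volume W ≠ ⊤ := fun W hW =>
    ne_top_of_le_ne_top (by simp) (measure_mono hW)
  have hXpos : 0 < volume.real X :=
    ENNReal.toReal_pos (hX.measure_pos volume hXne).ne' (hfin X hXl)
  have hYpos : 0 < volume.real Y :=
    ENNReal.toReal_pos (hY.measure_pos volume hYne).ne' (hfin Y hYl)
  refine le_of_forall_pos_sub_le fun ε hε => ?_
  obtain ⟨ε', hε', hεε, hεX, hεY⟩ : ∃ ε' : ℝ, 0 < ε' ∧ ε' ≤ ε / 3 ∧ ε' < volume.real X ∧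
      ε' < volume.real Y := by
    refine ⟨min (ε / 3) (min (volume.real X / 2) (volume.real Y / 2)), by positivity,
      min_le_left _ _, ?_, ?_⟩
    · exact ((min_le_right _ _).trans (min_le_left _ _)).trans_lt (by linarith)
    · exact ((min_le_right _ _).trans (min_le_right _ _)).trans_lt (by linarith)
  obtain ⟨P, hP⟩ := exists_volume_sub_le_card_openCell hl hX hXl hε'
  obtain ⟨Q, hQ⟩ := exists_volume_sub_le_card_openCell hl hY hYl hε'
  obtain ⟨R, hR⟩ := exists_nat_gt (l / ε')
  obtain ⟨p, hp, hpp⟩ := Nat.exists_infinite_primes (max P (max Q R))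
  have hpP : P ≤ p := (le_max_left _ _).trans hp
  have hpQ : Q ≤ p := ((le_max_left _ _).trans (le_max_right _ _)).trans hp
  have hpR : (R : ℝ) ≤ p := by
    exact_mod_cast ((le_max_right _ _).trans (le_max_right _ _)).trans hp
  have : NeZero p := ⟨hpp.ne_zero⟩
  have hp0 : (0 : ℝ) < p := by exact_mod_cast hpp.pos
  set η := l / p with hη
  have hη0 : 0 < η := by positivity
  have hpη : p * η = l := by rw [hη]; field_simp
  have hηε : η < ε' := by
    rw [hη, div_lt_iff₀ hp0]
    rw [div_lt_iff₀ hε'] at hR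
    nlinarith
  set s : Finset (ZMod p) := Finset.univ.filter fun i => openCell η i.val ⊆ X with hs
  set t : Finset (ZMod p) := Finset.univ.filter fun i => openCell η i.val ⊆ Y with ht
  have hsX := hP p hpP ‹_› s (by simp [hs, hη])
  have htY := hQ p hpQ ‹_› t (by simp [ht, hη])
  have hsne : s.Nonempty := by
    rw [Finset.nonempty_iff_ne_empty]
    intro h
    simp [h] at hsX
    linarith
  have htne : t.Nonempty := by
    rw [Finset.nonempty_iff_ne_empty]
    intro h
    simp [h] at htY
    linarith
  have hcd := ZMod.cauchy_davenport hpp hsne htne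
  have hsub : (⋃ i ∈ s + t, openCell η i.val) ⊆ Z := by
    refine Set.iUnion₂_subset fun w hw => ?_
    obtain ⟨i, hi, j, hj, rfl⟩ := Finset.mem_add.1 hw
    exact openCell_add_subset hl h1 h2 (Finset.mem_filter.1 hi).2 (Finset.mem_filter.1 hj).2
  have hdisj : ((s + t : Finset (ZMod p)) : Set (ZMod p)).PairwiseDisjoint
      fun i => openCell η i.val := by
    intro i _ j _ hij
    refine Set.disjoint_left.2 fun x hxi hxj => hij (ZMod.val_injective p ?_)
    have a1 : (i.val : ℝ) * η < (j.val + 1) * η := hxi.1.trans hxj.2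
    have a2 : (j.val : ℝ) * η < (i.val + 1) * η := hxj.1.trans hxi.2
    have b1 := lt_of_mul_lt_mul_right a1 hη0.le
    have b2 := lt_of_mul_lt_mul_right a2 hη0.le
    have c1 : i.val < j.val + 1 := by exact_mod_cast b1
    have c2 : j.val < i.val + 1 := by exact_mod_cast b2
    omega
  have hvol : ((s + t).card : ℝ) * η ≤ volume.real Z := by
    have := measureReal_mono hsub (hfin Z hZl)
    rw [measureReal_biUnion_finset hdisj (fun _ _ => measurableSet_Ioo)
      (fun _ _ => by simp [openCell])] at this
    simpa [volume_real_openCell hη0.le] using this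
  rcases min_le_iff.1 hcd with h | h
  · have h' : (p : ℝ) ≤ (s + t).card := by exact_mod_cast h
    have : l ≤ volume.real Z := by
      rw [← hpη]; exact (mul_le_mul_of_nonneg_right h' hη0.le).trans hvol
    linarith [min_le_left l (volume.real X + volume.real Y)]
  · have h' : (s.card + t.card : ℝ) ≤ (s + t).card + 1 := by
      have : s.card + t.card ≤ (s + t).card + 1 := by omega
      exact_mod_cast this
    have := mul_le_mul_of_nonneg_right h' hη0.le
    linarith [min_le_right l (volume.real X + volume.real Y)]

/-! ### The measure of a set between two reals -/

/-- The Lebesgue measure, as a real number, of the part of `S` between `a` and `b`. -/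
noncomputable def mass (S : Set ℝ) (a b : ℝ) : ℝ := volume.real (S ∩ Set.Ioo a b)

lemma mass_nonneg (S : Set ℝ) (a b : ℝ) : 0 ≤ mass S a b := measureReal_nonneg

lemma volume_inter_Ioo_ne_top (S : Set ℝ) (a b : ℝ) : volume (S ∩ Set.Ioo a b) ≠ ⊤ :=
  ne_top_of_le_ne_top (by simp) (measure_mono Set.inter_subset_right)

lemma mass_le_of_subset {S T : Set ℝ} {a b c d : ℝ}
    (h : S ∩ Set.Ioo a b ⊆ T ∩ Set.Ioo c d) : mass S a b ≤ mass T c d :=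
  measureReal_mono h (volume_inter_Ioo_ne_top T c d)

lemma mass_mono (S : Set ℝ) {a b c d : ℝ} (hca : c ≤ a) (hbd : b ≤ d) :
    mass S a b ≤ mass S c d :=
  mass_le_of_subset (Set.inter_subset_inter_right S (Set.Ioo_subset_Ioo hca hbd))

lemma mass_le_sub (S : Set ℝ) {a b : ℝ} (hab : a ≤ b) : mass S a b ≤ b - a := by
  rw [← Real.volume_real_Ioo_of_le hab]
  exact measureReal_mono Set.inter_subset_right (by simp)

lemma mass_self (S : Set ℝ) (a : ℝ) : mass S a a = 0 := by simp [mass]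

lemma mass_eq_zero {S : Set ℝ} {a b : ℝ} (h : ∀ s ∈ S, a < s → b ≤ s) : mass S a b = 0 := by
  have : S ∩ Set.Ioo a b = ∅ := Set.eq_empty_of_forall_notMem fun s hs =>
    (h s hs.1 hs.2.1).not_gt hs.2.2
  rw [mass, this, measureReal_empty]

lemma mass_add_mass {S : Set ℝ} (hS : IsOpen S) {a b c : ℝ} (hab : a ≤ b) (hbc : b ≤ c) :
    mass S a b + mass S b c = mass S a c := by
  have hm : ∀ x y, MeasurableSet (S ∩ Set.Ioo x y) := fun x y =>
    (hS.inter isOpen_Ioo).measurableSet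
  rw [mass, mass, mass, ← measureReal_union ?_ (hm b c) (volume_inter_Ioo_ne_top S a b)
    (volume_inter_Ioo_ne_top S b c)]
  · -- the two sides differ at most in the point `b`
    refine measureReal_congr ?_
    have hb : ∀ᵐ x ∂(volume : Measure ℝ), x ≠ b := by simp [ae_iff]
    filter_upwards [hb] with x hx
    apply propext
    change (x ∈ S ∩ Set.Ioo a b ∪ S ∩ Set.Ioo b c) ↔ x ∈ S ∩ Set.Ioo a c
    constructor
    · rintro (⟨h1, h2, h3⟩ | ⟨h1, h2, h3⟩)
      · exact ⟨h1, h2, h3.trans_le hbc⟩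
      · exact ⟨h1, hab.trans_lt h2, h3⟩
    · rintro ⟨h1, h2, h3⟩
      rcases lt_or_gt_of_ne hx with h | h
      · exact Or.inl ⟨h1, h2, h⟩
      · exact Or.inr ⟨h1, h, h3⟩
  · exact Set.disjoint_left.2 fun x hx hy => lt_asymm hx.2.2 hy.2.1

lemma volume_real_preimage_add_right {T : Set ℝ} (hT : IsOpen T) (c : ℝ) :
    volume.real ((fun x => x + c) ⁻¹' T) = volume.real T :=
  (measurePreserving_add_right volume c).measureReal_preimage hT.measurableSet.nullMeasurableSet

lemma volume_real_preimage_sub_left {T : Set ℝ} (hT : IsOpen T) (c : ℝ) :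
    volume.real ((fun x => c - x) ⁻¹' T) = volume.real T :=
  (volume.measurePreserving_sub_left c).measureReal_preimage
    hT.measurableSet.nullMeasurableSet

/-! ### Open semigroups of positive reals -/

/-- An open set of positive reals that is closed under addition. -/
structure IsOpenPosSemigroup (S : Set ℝ) : Prop where
  isOpen : IsOpen S
  pos : ∀ s ∈ S, 0 < s
  add_mem : ∀ s ∈ S, ∀ t ∈ S, s + t ∈ S

namespace IsOpenPosSemigroup

variable {S : Set ℝ}

/-- As `S` is open, it is closed under the addition of elements of its closure: the point of the
closure is approximated by an element of `S`, and the other summand absorbs the difference. -/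
lemma add_mem_of_mem_closure (hS : IsOpenPosSemigroup S) {s c : ℝ} (hs : s ∈ S)
    (hc : c ∈ closure S) : s + c ∈ S := by
  obtain ⟨ε, hε, hball⟩ := Metric.isOpen_iff.1 hS.isOpen s hs
  obtain ⟨t, ht, hct⟩ := Metric.mem_closure_iff.1 hc ε hε
  have := hS.add_mem (s + (c - t)) (hball (by simpa [Real.dist_eq] using hct)) t ht
  rwa [add_assoc, sub_add_cancel] at this

lemma add_nat_mul_mem (hS : IsOpenPosSemigroup S) {s c : ℝ} (hs : s ∈ S)
    (hc : c ∈ closure S) (n : ℕ) : s + n * c ∈ S := by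
  induction n with
  | zero => simpa using hs
  | succ n ih =>
    have := hS.add_mem_of_mem_closure ih hc
    push_cast
    rwa [add_mul, one_mul, ← add_assoc]

lemma mass_le_mass_add_nat_mul (hS : IsOpenPosSemigroup S) {c : ℝ} (hc : c ∈ closure S)
    (n : ℕ) (a b : ℝ) : mass S a b ≤ mass S (a + n * c) (b + n * c) := by
  rw [mass, mass, ← volume_real_preimage_add_right
    (T := S ∩ Set.Ioo (a + n * c) (b + n * c)) (hS.isOpen.inter isOpen_Ioo) (n * c)]
  refine measureReal_mono ?_ ?_
  · rintro x ⟨hx, h1, h2⟩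
    exact ⟨hS.add_nat_mul_mem hx hc n, by simpa using h1, by simpa using h2⟩
  · rw [(measurePreserving_add_right volume (n * c)).measure_preimage
      (hS.isOpen.inter isOpen_Ioo).measurableSet.nullMeasurableSet]
    exact volume_inter_Ioo_ne_top _ _ _

/-- If `v` is not in the semigroup, then the reflection `x ↦ v - x` maps the semigroup to its
complement. -/
lemma mass_add_mass_reflect_le (hS : IsOpenPosSemigroup S) {v : ℝ} (hv : v ∉ S) {a b : ℝ}
    (hab : a ≤ b) : mass S a b + mass S (v - b) (v - a) ≤ b - a := by
  have ho : IsOpen (S ∩ Set.Ioo (v - b) (v - a)) := hS.isOpen.inter isOpen_Ioo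
  have hsub : (fun x => v - x) ⁻¹' (S ∩ Set.Ioo (v - b) (v - a)) ⊆ Set.Ioo a b := by
    rintro x ⟨_, h1, h2⟩
    exact ⟨by linarith, by linarith⟩
  rw [mass, mass, ← volume_real_preimage_sub_left ho v,
    ← measureReal_union ?_ (ho.preimage (by fun_prop)).measurableSet
      (volume_inter_Ioo_ne_top _ _ _) (ne_top_of_le_ne_top (by simp) (measure_mono hsub)),
    ← Real.volume_real_Ioo_of_le hab]
  · exact measureReal_mono (Set.union_subset Set.inter_subset_right hsub) (by simp)
  · refine Set.disjoint_left.2 fun x hx hy => hv ?_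
    have := hS.add_mem x hx.1 (v - x) hy.1
    rwa [add_sub_cancel] at this

/-- If `u` is not in the semigroup, then half of `(0, u)` is missing from it. -/
lemma two_mul_mass_le (hS : IsOpenPosSemigroup S) {u : ℝ} (hu : u ∉ S) (hu0 : 0 ≤ u) :
    2 * mass S 0 u ≤ u := by
  have := hS.mass_add_mass_reflect_le hu hu0
  simp only [sub_self, sub_zero] at this
  linarith

/-- Modulo a period `l`, the windows of length `l` below `y` and below `z` are too small to cover
the circle by their sums, as long as those sums are represented by numbers that are at most
`u ∉ S` in the class of `u`. -/
lemma mass_add_mass_le_period (hS : IsOpenPosSemigroup S) {l u : ℝ} (hl : 0 < l)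
    (hlS : l ∈ closure S) (hu : u ∉ S) {y z : ℝ} (hyz : y + z ≤ u + l) :
    mass S (y - l) y + mass S (z - l) z ≤ l := by
  set n := ⌊(u - (y + z - l)) / l⌋₊ with hn
  have h1 := Nat.floor_le (a := (u - (y + z - l)) / l) (div_nonneg (by linarith) hl.le)
  have h2 := Nat.lt_floor_add_one ((u - (y + z - l)) / l)
  rw [← hn, le_div_iff₀ hl] at h1
  rw [← hn, div_lt_iff₀ hl] at h2
  obtain ⟨v, hv⟩ : ∃ v, v = u - n * l := ⟨_, rfl⟩
  have hvS : v ∉ S := fun h => hu (by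
    have := hS.add_nat_mul_mem h hlS n
    rwa [hv, sub_add_cancel] at this)
  have hvS' : v - l ∉ S := fun h => hvS (by
    have := hS.add_mem_of_mem_closure h hlS
    rwa [sub_add_cancel] at this)
  -- the window below `z` is reflected piecewise into the window below `y`
  have e1 := hS.mass_add_mass_reflect_le hvS' (a := y - l) (b := v - z) (by nlinarith)
  have e2 := hS.mass_add_mass_reflect_le hvS (a := v - z) (b := y) (by nlinarith)
  have e3 := mass_add_mass hS.isOpen (a := y - l) (b := v - z) (c := y) (by nlinarith)
    (by nlinarith)
  have e4 := mass_add_mass hS.isOpen (a := z - l) (b := v - y) (c := z) (by nlinarith)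
    (by nlinarith)
  rw [show v - l - (v - z) = z - l by ring, show v - l - (y - l) = v - y by ring] at e1
  rw [show v - (v - z) = z by ring] at e2
  linarith

/-- The measure of a window whose length is a period does not decrease when the window moves to
the right. -/
lemma mass_window_mono (hS : IsOpenPosSemigroup S) {l : ℝ} (hl : 0 < l) (hlS : l ∈ closure S)
    {y z : ℝ} (hy : 0 ≤ y) : mass S (z - l) z ≤ mass S (y + z - l) (y + z) := by
  set n := ⌊y / l⌋₊ with hn
  have h1 := Nat.floor_le (a := y / l) (by positivity)
  have h2 := Nat.lt_floor_add_one (y / l)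
  rw [← hn, le_div_iff₀ hl] at h1
  rw [← hn, div_lt_iff₀ hl] at h2
  -- the left end of the window moves by one period more than the rest
  have e1 := hS.mass_le_mass_add_nat_mul hlS (n + 1) (z - l) (y + z - l - n * l)
  have e2 := hS.mass_le_mass_add_nat_mul hlS n (y + z - l - n * l) z
  have e3 := mass_add_mass hS.isOpen (a := z - l) (b := y + z - l - n * l) (c := z)
    (by linarith) (by linarith)
  have e4 := mass_add_mass hS.isOpen (a := y + z - l) (b := z + n * l) (c := y + z)
    (by linarith) (by linarith)
  rw [show z - l + ((n + 1 : ℕ) : ℝ) * l = z + n * l by push_cast; ring,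
    show y + z - l - n * l + ((n + 1 : ℕ) : ℝ) * l = y + z by push_cast; ring] at e1
  rw [show y + z - l - n * l + n * l = y + z - l by ring] at e2
  linarith

/-- The measure of the window of length `l` below `y` is superadditive in `y` for every period `l`,
as long as the sumset modulo `l` does not fill the circle. -/
lemma mass_window_add_le (hS : IsOpenPosSemigroup S) {l u : ℝ} (hl : 0 < l)
    (hlS : l ∈ closure S) (hu : u ∉ S) {y z : ℝ} (hy : 0 ≤ y) (hz : 0 ≤ z)
    (hyz : y + z ≤ u + l) :
    mass S (y - l) y + mass S (z - l) z ≤ mass S (y + z - l) (y + z) := by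
  have hcap := hS.mass_add_mass_le_period hl hlS hu hyz
  rcases (S ∩ Set.Ioo (y - l) y).eq_empty_or_nonempty with hX | hX
  · have : mass S (y - l) y = 0 := by simp [mass, hX]
    rw [this, zero_add]
    exact hS.mass_window_mono hl hlS hy
  rcases (S ∩ Set.Ioo (z - l) z).eq_empty_or_nonempty with hY | hY
  · have : mass S (z - l) z = 0 := by simp [mass, hY]
    rw [this, add_zero, add_comm y z]
    exact hS.mass_window_mono hl hlS hz
  have ho : ∀ a b, IsOpen (S ∩ Set.Ioo a b) := fun a b => hS.isOpen.inter isOpen_Ioo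
  have hsub : ∀ w : ℝ, (fun x => x + (w - l)) ⁻¹' (S ∩ Set.Ioo (w - l) w) ⊆ Set.Ioo 0 l := by
    rintro w x ⟨_, h1, h2⟩
    exact ⟨by linarith, by linarith⟩
  have hne : ∀ w : ℝ, (S ∩ Set.Ioo (w - l) w).Nonempty →
      ((fun x => x + (w - l)) ⁻¹' (S ∩ Set.Ioo (w - l) w)).Nonempty := by
    rintro w ⟨x, hx⟩
    exact ⟨x - (w - l), by rwa [Set.mem_preimage, sub_add_cancel]⟩
  have key := min_le_volume_of_add_mem hl ((ho (y - l) y).preimage (continuous_add_const (y - l)))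
    ((ho (z - l) z).preimage (continuous_add_const (z - l))) (hsub y) (hsub z) (hsub (y + z))
    (hne y hX) (hne z hY) ?_ ?_
  · rw [volume_real_preimage_add_right (ho _ _), volume_real_preimage_add_right (ho _ _),
      volume_real_preimage_add_right (ho _ _)] at key
    exact (min_eq_right hcap).symm.trans_le key
  · rintro x ⟨hx, hx1, hx2⟩ x' ⟨hx', hx1', hx2'⟩ hlt
    refine ⟨?_, by linarith, by linarith⟩
    have := hS.add_mem_of_mem_closure (hS.add_mem _ hx _ hx') hlS
    convert this using 1
    ring
  · rintro x ⟨hx, hx1, hx2⟩ x' ⟨hx', hx1', hx2'⟩ hlt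
    refine ⟨?_, by linarith, by linarith⟩
    have := hS.add_mem _ hx _ hx'
    convert this using 1
    ring


/-! ### Bounds from the density of the semigroup -/

/-- The gap bound. With the supremum `l` of `S ∩ (0, c)` as a period, the `j`-th window of length
`l` contains a part of `S` of measure at least `j` times that of the first one. If `u` is not in `S`,
then these parts fill at most half of `(0, u)`. -/
lemma exists_le_nat_mul_sub (hS : IsOpenPosSemigroup S) {c u : ℝ} (hc : 0 < c) (hu : u ∉ S)
    (hu0 : 0 < u) : ∃ K : ℕ, u ≤ K * (2 * c - mass S 0 c * (K + 1)) := by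
  rcases (S ∩ Set.Ioo 0 c).eq_empty_or_nonempty with hX | hX
  · obtain ⟨K, hK⟩ := exists_nat_gt (u / (2 * c))
    rw [div_lt_iff₀ (by positivity)] at hK
    exact ⟨K, by simp [mass, hX]; linarith⟩
  have hbdd : BddAbove (S ∩ Set.Ioo 0 c) := ⟨c, fun x hx => hx.2.2.le⟩
  set l := sSup (S ∩ Set.Ioo 0 c) with hl
  have hlS : l ∈ closure S :=
    closure_mono Set.inter_subset_left (csSup_mem_closure hX hbdd)
  have hl0 : 0 < l := by
    obtain ⟨x, hx⟩ := hX
    exact hx.2.1.trans_le (le_csSup hbdd hx)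
  have hlc : l ≤ c := csSup_le hX fun x hx => hx.2.2.le
  have ha : mass S 0 c = mass S 0 l := by
    refine le_antisymm ?_ (mass_mono S le_rfl hlc)
    rw [← mass_add_mass hS.isOpen hl0.le hlc, mass_eq_zero (a := l), add_zero]
    intro x hx hlx
    by_contra! hxc
    exact (le_csSup hbdd ⟨hx, hl0.trans hlx, hxc⟩).not_gt hlx
  rw [ha]
  set a := mass S 0 l with hadef
  set n := ⌊u / l⌋₊ with hn
  have hn1 := Nat.floor_le (a := u / l) (by positivity)
  have hn2 := Nat.lt_floor_add_one (u / l)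
  rw [← hn, le_div_iff₀ hl0] at hn1
  rw [← hn, div_lt_iff₀ hl0] at hn2
  have hwin : ∀ j : ℕ, j ≤ n → (j + 1) * a ≤ mass S (j * l) ((j + 1) * l) := by
    intro j
    induction j with
    | zero => intro _; simp [hadef]
    | succ j ih =>
      intro hj
      have hjn : ((j : ℝ) + 1) * l ≤ n * l := by
        have : (j : ℝ) + 1 ≤ n := by exact_mod_cast hj
        gcongr
      have := hS.mass_window_add_le hl0 hlS hu (y := (j + 1) * l) (z := l) (by positivity) hl0.le
        (by linarith)
      rw [show ((j : ℝ) + 1) * l - l = j * l by ring, sub_self, ← hadef,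
        show ((j : ℝ) + 1) * l + l - l = (j + 1) * l by ring,
        show ((j : ℝ) + 1) * l + l = (j + 1 + 1) * l by ring] at this
      push_cast
      linarith [ih (by omega)]
  have hsum : ∀ j : ℕ, j ≤ n + 1 → a * (j * (j + 1) / 2) ≤ mass S 0 (j * l) := by
    intro j
    induction j with
    | zero => intro _; simp [mass_self]
    | succ j ih =>
      intro hj
      have e := mass_add_mass hS.isOpen (a := 0) (b := j * l) (c := (j + 1) * l) (by positivity)
        (by gcongr; linarith)
      push_cast
      linarith [ih (by omega), hwin j (by omega)]
  have h1 := hsum (n + 1) le_rfl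
  push_cast at h1
  have h2 := mass_add_mass hS.isOpen hu0.le hn2.le
  have h3 := mass_le_sub S hn2.le
  have h4 := hS.two_mul_mass_le hu hu0.le
  refine ⟨n + 1, ?_⟩
  push_cast
  nlinarith

/-- The gap bound, maximised over real values of the number of windows. -/
lemma four_mul_mass_mul_le_sq (hS : IsOpenPosSemigroup S) {c u : ℝ} (hc : 0 < c) (hu : u ∉ S)
    (hu0 : 0 < u) : 4 * mass S 0 c * u ≤ (2 * c - mass S 0 c) ^ 2 := by
  obtain ⟨K, hK⟩ := hS.exists_le_nat_mul_sub hc hu hu0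
  have := mul_le_mul_of_nonneg_left hK (mass_nonneg S 0 c)
  nlinarith [sq_nonneg (2 * c - mass S 0 c - 2 * (mass S 0 c * K))]

/-! ### Doubling on the line -/

/-- **Freiman's `3k - 4` theorem** for open sets of reals: the sumset of an open set with infimum
`c` and supremum `d` is large. Modulo `d - c` Raikov's theorem applies, and the translates of the
set by `c` and by `d` coincide. -/
lemma mass_add_min_le_mass_two_mul (hS : IsOpenPosSemigroup S) {c d : ℝ} (hcd : c < d)
    (hc : c ∈ closure S) (hd : d ∈ closure S) (hne : (S ∩ Set.Ioo c d).Nonempty) :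
    mass S c d + min (d - c) (2 * mass S c d) ≤ mass S (2 * c) (2 * d) := by
  have ho : ∀ a b, IsOpen (S ∩ Set.Ioo a b) := fun a b => hS.isOpen.inter isOpen_Ioo
  set X : Set ℝ := (fun x => x + c) ⁻¹' (S ∩ Set.Ioo c d) with hX
  set Z₁ : Set ℝ := (fun x => x + 2 * c) ⁻¹' (S ∩ Set.Ioo (2 * c) (c + d)) with hZ₁
  set Z₂ : Set ℝ := (fun x => x + (c + d)) ⁻¹' (S ∩ Set.Ioo (c + d) (2 * d)) with hZ₂
  have hXo : IsOpen X := (ho _ _).preimage (continuous_add_const c)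
  have hZ₂o : IsOpen Z₂ := (ho _ _).preimage (continuous_add_const (c + d))
  have hXs : X ⊆ Set.Ioo 0 (d - c) := by
    rintro x ⟨_, h1, h2⟩
    exact ⟨by linarith, by linarith⟩
  have hZ₁s : Z₁ ⊆ Set.Ioo 0 (d - c) := by
    rintro x ⟨_, h1, h2⟩
    exact ⟨by linarith, by linarith⟩
  have hZ₂s : Z₂ ⊆ Set.Ioo 0 (d - c) := by
    rintro x ⟨_, h1, h2⟩
    exact ⟨by linarith, by linarith⟩
  have hXne : X.Nonempty := by
    obtain ⟨x, hx⟩ := hne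
    exact ⟨x - c, by rwa [hX, Set.mem_preimage, sub_add_cancel]⟩
  have hfin : ∀ W : Set ℝ, W ⊆ Set.Ioo 0 (d - c) → volume W ≠ ⊤ := fun W hW =>
    ne_top_of_le_ne_top (by simp) (measure_mono hW)
  have hraikov := min_le_volume_of_add_mem (Z := Z₁ ∪ Z₂) (sub_pos.2 hcd) hXo hXo hXs hXs
    (Set.union_subset hZ₁s hZ₂s) hXne hXne
    (by
      rintro x ⟨hx, hx1, hx2⟩ y ⟨hy, hy1, hy2⟩ hlt
      refine Or.inl ⟨?_, by linarith, by linarith⟩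
      have := hS.add_mem _ hx _ hy
      convert this using 1
      ring)
    (by
      rintro x ⟨hx, hx1, hx2⟩ y ⟨hy, hy1, hy2⟩ hlt
      refine Or.inr ⟨?_, by linarith, by linarith⟩
      have := hS.add_mem _ hx _ hy
      convert this using 1
      ring)
  have hinter : X ⊆ Z₁ ∩ Z₂ := by
    rintro x ⟨hx, hx1, hx2⟩
    refine ⟨⟨?_, by linarith, by linarith⟩, ⟨?_, by linarith, by linarith⟩⟩
    · have := hS.add_mem_of_mem_closure hx hc
      convert this using 1
      ring
    · have := hS.add_mem_of_mem_closure hx hd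
      convert this using 1
      ring
  have h1 := measureReal_mono hinter
    (hfin _ (Set.inter_subset_left.trans hZ₁s))
  have h2 := measureReal_union_add_inter (s := Z₁) hZ₂o.measurableSet (hfin _ hZ₁s) (hfin _ hZ₂s)
  have h3 := mass_add_mass hS.isOpen (a := 2 * c) (b := c + d) (c := 2 * d) (by linarith)
    (by linarith)
  rw [hX, volume_real_preimage_add_right (ho _ _)] at h1 hraikov
  rw [hZ₁, hZ₂, volume_real_preimage_add_right (ho _ _),
    volume_real_preimage_add_right (ho _ _), ← hZ₁, ← hZ₂] at h2
  rw [← two_mul] at hraikov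
  change min (d - c) (2 * mass S c d) ≤ _ at hraikov
  change mass S c d ≤ _ at h1
  change _ = mass S _ _ + mass S _ _ at h2
  linarith


/-! ### Semigroups that are dense in a short interval -/

/-- If `S` has measure `β` in an interval `(1 - x, 1)` with `3 x < 4 β`, then the sums of two elements
fill a long interval. -/
lemma two_sub_mem_of_dense (hS : IsOpenPosSemigroup S) {x v : ℝ}
    (hv : 2 * (x - mass S (1 - x) 1) < v) (hv' : v < 2 * mass S (1 - x) 1) (hx : 0 < x) :
    2 - v ∈ S := by
  by_contra h
  have hβ := mass_le_sub S (a := 1 - x) (b := 1) (by linarith)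
  rcases le_total v x with hvx | hvx
  · have h1 := hS.mass_add_mass_reflect_le h (a := 1 - v) (b := 1) (by linarith)
    rw [show 2 - v - 1 = 1 - v by ring, show 2 - v - (1 - v) = 1 by ring] at h1
    have h2 := mass_add_mass hS.isOpen (a := 1 - x) (b := 1 - v) (c := 1) (by linarith)
      (by linarith)
    have h3 := mass_le_sub S (a := 1 - x) (b := 1 - v) (by linarith)
    linarith
  · have h1 := hS.mass_add_mass_reflect_le h (a := 1 - x) (b := 1 - v + x) (by linarith)
    rw [show 2 - v - (1 - v + x) = 1 - x by ring,
      show 2 - v - (1 - x) = 1 - v + x by ring] at h1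
    have h2 := mass_add_mass hS.isOpen (a := 1 - x) (b := 1 - v + x) (c := 1) (by linarith)
      (by linarith)
    have h3 := mass_le_sub S (a := 1 - v + x) (b := 1) (by linarith)
    linarith

/-- In the situation of `two_sub_mem_of_dense`, if `1 - x` and `1` lie in the closure of `S`, then
the sums of `j` elements fill `(j (1 - x), j)`, except for a piece of length
`2 (x - β)` at either end. -/
lemma nat_sub_mem_of_dense (hS : IsOpenPosSemigroup S) {x v : ℝ} (hx : 0 < x)
    (hxS : 1 - x ∈ closure S) (h1S : (1 : ℝ) ∈ closure S)
    (hβ : 3 * x < 4 * mass S (1 - x) 1) {j : ℕ} (hj : 2 ≤ j)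
    (hv : 2 * (x - mass S (1 - x) 1) < v)
    (hv' : v < j * x - 2 * (x - mass S (1 - x) 1)) : (j : ℝ) - v ∈ S := by
  set β := mass S (1 - x) 1 with hβdef
  -- `i` of the summands are `1 - x`, all but two of the others are `1`
  obtain ⟨i, hi, hi1, hi2⟩ : ∃ i : ℕ, i + 2 ≤ j ∧ 2 * (x - β) < v - i * x ∧
      v - i * x < 2 * β := by
    rcases lt_or_ge v (2 * β) with h | h
    · exact ⟨0, by omega, by simpa using hv, by simpa using h⟩
    have h1 := Nat.floor_le (a := (v - 2 * β) / x) (div_nonneg (by linarith) hx.le)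
    have h2 := Nat.lt_floor_add_one ((v - 2 * β) / x)
    set i := ⌊(v - 2 * β) / x⌋₊
    rw [le_div_iff₀ hx] at h1
    rw [div_lt_iff₀ hx] at h2
    refine ⟨i + 1, ?_, ?_, ?_⟩
    · have : ((i + 2 : ℕ) : ℝ) * x < j * x := by push_cast; linarith
      have : i + 2 < j := by exact_mod_cast lt_of_mul_lt_mul_right this hx.le
      omega
    · push_cast; linarith
    · push_cast; linarith
  obtain ⟨n, rfl⟩ := Nat.exists_eq_add_of_le hi
  have h := hS.add_nat_mul_mem (hS.add_nat_mul_mem (hS.two_sub_mem_of_dense hi1 hi2 hx) hxS i)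
    h1S n
  convert h using 1
  push_cast
  ring

/-! ### Sparse semigroups whose elements below `1` accumulate at `1` -/

/-- Superadditivity of the windows, for equal summands. -/
lemma nat_mul_mass_window_le (hS : IsOpenPosSemigroup S) {l u y : ℝ} (hl : 0 < l)
    (hlS : l ∈ closure S) (hu : u ∉ S) (hy : 0 ≤ y) (j : ℕ) (hj : j * y ≤ u + l) :
    j * mass S (y - l) y ≤ mass S (j * y - l) (j * y) := by
  induction j with
  | zero => simpa using mass_nonneg S _ _
  | succ j ih =>
    push_cast at hj ⊢
    have := hS.mass_window_add_le hl hlS hu (y := j * y) (z := y) (by positivity) hy (by linarith)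
    rw [show ((j : ℝ) + 1) * y = j * y + y by ring]
    linarith [ih (by linarith)]

variable {α u : ℝ} {k : ℕ}

/-- The `j`-th window of length `1` contains little more of `S` than the guaranteed `j α`: it does
not cover the circle together with the `k - j` further windows available, which contain at least
`(k - j) α`. -/
lemma mass_unit_window_lt (hS : IsOpenPosSemigroup S) (h1S : (1 : ℝ) ∈ closure S)
    (hα1 : α ≤ mass S 0 1) (hk1 : 1 < (k + 1) * α) (hu : u ∉ S) (huk : k ≤ u + 1)
    {j : ℕ} (hj : j ≤ k) : mass S (j - 1) j < (j + 1) * α := by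
  obtain ⟨i, rfl⟩ := Nat.exists_eq_add_of_le hj
  push_cast at hk1 huk
  have h1 := hS.mass_add_mass_le_period one_pos h1S hu (y := j) (z := i) huk
  have h2 := hS.nat_mul_mass_window_le one_pos h1S hu zero_le_one i (by
    have : (0 : ℝ) ≤ j := by positivity
    linarith)
  rw [sub_self, mul_one] at h2
  have : (i : ℝ) * α ≤ i * mass S 0 1 := by gcongr
  linarith

/-- An element `l ≤ 1 / 2` of the semigroup forces `S` to be sparse in `(1 - l, 1)`: each of the two
windows of length `l` in a window of length `1` grows at the rate of the measure of `S` in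
`(1 - l, 1)`. -/
lemma mass_near_one_lt (hS : IsOpenPosSemigroup S) (h1S : (1 : ℝ) ∈ closure S)
    (hα1 : α ≤ mass S 0 1) (hk1 : 1 < (k + 1) * α) (hu : u ∉ S) (huk : k ≤ u + 1)
    (hk : 10 ≤ k) {l : ℝ} (hl : l ∈ S) (hl2 : l ≤ 1 / 2) :
    17 * mass S (1 - l) 1 < 10 * α := by
  have hl0 := hS.pos l hl
  have hk' : (10 : ℝ) ≤ k := by exact_mod_cast hk
  have h9 := hS.mass_unit_window_lt h1S hα1 hk1 hu huk (j := 9) (by omega)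
  have e9 := hS.nat_mul_mass_window_le hl0 (subset_closure hl) hu zero_le_one 9
    (by push_cast; linarith)
  have e8 := hS.nat_mul_mass_window_le hl0 (subset_closure hl) hu zero_le_one 8
    (by push_cast; linarith)
  have e8' := hS.mass_window_mono hl0 (subset_closure hl) (y := 1 - l) (z := 8) (by linarith)
  push_cast at h9 e9 e8
  norm_num at h9 e9 e8
  rw [show 1 - l + 8 - l = 9 - l - l by ring, show 1 - l + 8 = 9 - l by ring] at e8'
  have hsplit := mass_add_mass hS.isOpen (a := 9 - l - l) (b := 9 - l) (c := 9) (by linarith)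
    (by linarith)
  have := mass_mono S (a := 9 - l - l) (b := 9) (c := 8) (d := 9) (by linarith) le_rfl
  linarith

/-- The measure of `S` in `(0, c)` is at most of the order `c ^ 2` if `S` has a large gap `u`. -/
lemma mass_le_sq (hS : IsOpenPosSemigroup S) (hα : 0 < α) (hα10 : α ≤ 1 / 10) (hu : u ∉ S)
    (hαu : (1 - α) ^ 2 ≤ α * u) {c : ℝ} (hc : 0 < c) :
    81 * mass S 0 c ≤ 100 * c ^ 2 * α := by
  have hn := mass_nonneg S 0 c
  have hnc := mass_le_sub S hc.le
  have hu0 : 0 < u := pos_of_mul_pos_right (lt_of_lt_of_le (by nlinarith) hαu) hα.le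
  have h := hS.four_mul_mass_mul_le_sq hc hu hu0
  set n := mass S 0 c
  have h1 : 4 * n * u ≤ 4 * c ^ 2 := by nlinarith
  have h2 : (81 / 100 : ℝ) ≤ α * u := by nlinarith
  have h3 : n * (81 / 100) ≤ n * (α * u) := by gcongr
  nlinarith

/-- The first bound for `G(A)`, under the assumption that the elements of the semigroup below `1`
accumulate at `1`. -/
theorem le_one_sub_mul_floor (hS : IsOpenPosSemigroup S)
    (h1 : (1 : ℝ) ∈ closure (S ∩ Set.Ioo 0 1)) (hα : 0 < α) (hα10 : α ≤ 1 / 10)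
    (hα1 : α ≤ mass S 0 1) (hu : u ∉ S) : u ≤ (1 - α) * (⌊1 / α⌋₊ : ℝ) := by
  by_contra! hlt
  have hkα := Nat.floor_le (a := 1 / α) (by positivity)
  have hk1 := Nat.lt_floor_add_one (1 / α)
  have hk : 10 ≤ ⌊1 / α⌋₊ := Nat.le_floor (by
    rw [le_div_iff₀ hα]; push_cast; linarith)
  set k := ⌊1 / α⌋₊
  rw [le_div_iff₀ hα] at hkα
  rw [div_lt_iff₀ hα] at hk1
  have hk' : (10 : ℝ) ≤ k := by exact_mod_cast hk
  have huk : (k : ℝ) ≤ u + 1 := by linarith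
  have hαu : (1 - α) ^ 2 ≤ α * u := by nlinarith
  have h1S : (1 : ℝ) ∈ closure S := closure_mono Set.inter_subset_left h1
  have hmem_lt : ∀ y < (1 : ℝ), ∃ s ∈ S, y < s ∧ s < 1 := by
    intro y hy
    obtain ⟨s, hs, hs'⟩ := Metric.mem_closure_iff.1 h1 (1 - y) (by linarith)
    rw [Real.dist_eq, abs_of_pos (by linarith [hs.2.2])] at hs'
    exact ⟨s, hs.1, by linarith, hs.2.2⟩
  -- the window below `k + 1` would cover the circle
  have huk1 : u < k := by
    by_contra! h
    have e1 := hS.mass_add_mass_le_period one_pos h1S hu (y := k) (z := 1) (by linarith)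
    have e2 := hS.nat_mul_mass_window_le one_pos h1S hu zero_le_one k (by linarith)
    rw [sub_self, mul_one] at e2
    rw [sub_self] at e1
    nlinarith
  -- small doubling modulo `1`
  have hdouble : 5 * mass S 1 2 < 11 * α := by
    have e1 := hS.mass_unit_window_lt h1S hα1 hk1 hu huk (j := 10) hk
    have e2 := hS.nat_mul_mass_window_le one_pos h1S hu (y := 2) (by norm_num) 5
      (by push_cast; linarith)
    norm_num at e1 e2
    linarith
  have hlaw55 := hS.mass_le_sq hα hα10 hu hαu (c := 55 / 100) (by norm_num)
  have hlaw45 := hS.mass_le_sq hα hα10 hu hαu (c := 45 / 100) (by norm_num)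
  have hsmall : ∀ l ∈ S, l ≤ 1 / 2 → 17 * mass S (1 - l) 1 < 10 * α := fun l hl hl2 =>
    hS.mass_near_one_lt h1S hα1 hk1 hu huk hk hl hl2
  -- an element near `1 / 2` would put a large part of `S` below `0.55`
  have hgap : ∀ l ∈ S, l ≤ 1 / 2 → l < 45 / 100 := by
    intro l hl hl2
    by_contra! hl45
    have e1 := hsmall l hl hl2
    have e2 := mass_add_mass hS.isOpen (a := 0) (b := 1 - l) (c := 1) (by linarith) (by linarith)
    have e3 := mass_mono S (a := 0) (b := 1 - l) (c := 0) (d := 55 / 100) le_rfl (by linarith)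
    norm_num at hlaw55
    linarith
  have hhalf : mass S 0 (1 / 2) ≤ mass S 0 (45 / 100) :=
    mass_le_of_subset fun s hs => ⟨hs.1, hs.2.1, hgap s hs.1 hs.2.2.le⟩
  have hU := mass_add_mass hS.isOpen (a := 0) (b := 1 / 2) (c := 1) (by norm_num) (by norm_num)
  norm_num at hlaw45
  have hUα : 3 / 4 * α ≤ mass S (1 / 2) 1 := by linarith
  -- the part of `S` in `(1 / 2, 1)` lies in the short interval `(c, 1)`
  have hUne : (S ∩ Set.Ioo (1 / 2) 1).Nonempty := by
    obtain ⟨s, hs, h2, h3⟩ := hmem_lt (1 / 2) (by norm_num)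
    exact ⟨s, hs, h2, h3⟩
  have hbdd : BddBelow (S ∩ Set.Ioo (1 / 2) 1) := ⟨1 / 2, fun s hs => hs.2.1.le⟩
  obtain ⟨c, hc⟩ : ∃ c, c = sInf (S ∩ Set.Ioo (1 / 2) 1) := ⟨_, rfl⟩
  have hcS : c ∈ closure S := by
    rw [hc]; exact closure_mono Set.inter_subset_left (csInf_mem_closure hUne hbdd)
  have hc2 : 1 / 2 ≤ c := by rw [hc]; exact le_csInf hUne fun s hs => hs.2.1.le
  have hc1 : c < 1 := by
    obtain ⟨s, hs⟩ := hUne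
    rw [hc]; exact (csInf_le hbdd hs).trans_lt hs.2.2
  have hUc : mass S (1 / 2) 1 = mass S c 1 := by
    refine le_antisymm ?_ (mass_mono S hc2 le_rfl)
    rw [← mass_add_mass hS.isOpen hc2 hc1.le, mass_eq_zero (b := c), zero_add]
    intro s hs h2
    by_contra! hsc
    exact (hc.trans_le (csInf_le hbdd ⟨hs, h2, hsc.trans hc1⟩)).not_gt hsc
  have hshort : 1 - c ≤ mass S 1 2 - mass S c 1 := by
    have e1 := hS.mass_add_min_le_mass_two_mul hc1 hcS h1S (by
      obtain ⟨s, hs, h2, h3⟩ := hmem_lt c hc1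
      exact ⟨s, hs, h2, h3⟩)
    have e2 := mass_mono S (a := 2 * c) (b := 2 * 1) (c := 1) (d := 2) (by linarith) (by norm_num)
    rcases min_choice (1 - c) (2 * mass S c 1) with h | h <;> rw [h] at e1 <;> linarith
  -- so `S` has no elements below `1 / 2`, as some multiple of such an element would be a period
  -- between `1 - c` and `1 / 2`
  have hempty : ∀ l ∈ S, 1 / 2 < l := by
    intro l hl
    by_contra! hl2
    have hl0 := hS.pos l hl
    have hfl1 := Nat.floor_le (a := (1 / 2) / l) (by positivity)
    have hfl2 := Nat.lt_floor_add_one ((1 / 2) / l)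
    have hfl3 : 1 ≤ ⌊(1 / 2) / l⌋₊ := Nat.le_floor (by
      rw [le_div_iff₀ hl0]; push_cast; linarith)
    set n := ⌊(1 / 2) / l⌋₊
    rw [le_div_iff₀ hl0] at hfl1
    rw [div_lt_iff₀ hl0] at hfl2
    obtain ⟨i, hi⟩ := Nat.exists_eq_add_of_le hfl3
    have hmem : n * l ∈ S := by
      have := hS.add_nat_mul_mem hl (subset_closure hl) i
      rw [hi]
      convert this using 1
      push_cast
      ring
    have hnl : 1 / 4 ≤ n * l := by
      have : (1 : ℝ) ≤ n := by exact_mod_cast hfl3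
      nlinarith
    have e1 := hsmall _ hmem hfl1
    have e2 := mass_mono S (a := c) (b := 1) (c := 1 - n * l) (d := 1) (by linarith) le_rfl
    linarith
  have hzero : mass S 0 (1 / 2) = 0 := mass_eq_zero fun s hs _ => (hempty s hs).le
  -- `u` is a sum of `k` or of `k + 1` elements
  obtain ⟨x, hx⟩ : ∃ x, x = 1 - c := ⟨_, rfl⟩
  obtain rfl : c = 1 - x := by linarith
  have hβ : α ≤ mass S (1 - x) 1 := by linarith
  have hβx := mass_le_sub S (a := 1 - x) (b := 1) hc1.le
  have hx0 : 0 < x := by linarith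
  rcases lt_or_ge (2 * (x - mass S (1 - x) 1)) (k - u) with hv | hv
  · have := hS.nat_sub_mem_of_dense hx0 hcS h1S (by linarith) (j := k) (by omega) hv
      (by nlinarith)
    rw [sub_sub_cancel] at this
    exact hu this
  · have := hS.nat_sub_mem_of_dense hx0 hcS h1S (v := k + 1 - u) (by linarith) (j := k + 1)
      (by omega) (by linarith) (by push_cast; nlinarith)
    push_cast at this
    rw [sub_sub_cancel] at this
    exact hu this

end IsOpenPosSemigroup

namespace IsOpenPosSemigroup

variable {S : Set ℝ} {α u : ℝ}

/-! ### Rescaling -/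

lemma preimage_mul_left (hS : IsOpenPosSemigroup S) {l : ℝ} (hl : 0 < l) :
    IsOpenPosSemigroup ((fun x => l * x) ⁻¹' S) where
  isOpen := hS.isOpen.preimage (by fun_prop)
  pos s hs := pos_of_mul_pos_right (hS.pos _ hs) hl.le
  add_mem s hs t ht := by
    have := hS.add_mem _ hs _ ht
    rwa [← mul_add] at this

lemma mul_mass_preimage_mul_left (S : Set ℝ) {l : ℝ} (hl : 0 < l) :
    l * mass ((fun x => l * x) ⁻¹' S) 0 1 = mass S 0 l := by
  have : (fun x => l * x) ⁻¹' S ∩ Set.Ioo 0 1 = (fun x => l * x) ⁻¹' (S ∩ Set.Ioo 0 l) := by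
    ext x
    simp only [Set.mem_inter_iff, Set.mem_preimage, Set.mem_Ioo, hl, mul_pos_iff_of_pos_left,
      mul_lt_iff_lt_one_right]
  rw [mass, this, mass, measureReal_def, Real.volume_preimage_mul_left hl.ne',
    ENNReal.toReal_mul, ENNReal.toReal_ofReal (abs_nonneg _), abs_of_pos (inv_pos.2 hl),
    mul_inv_cancel_left₀ hl.ne', measureReal_def]

/-- The first bound for `G(A)`. If the relative measure `α / l` of the semigroup in `(0, l)` exceeds
`1 / 10`, then the gap bound is already strong enough. -/
theorem le_one_sub_mul_floor_of_le_one (hS : IsOpenPosSemigroup S) {l : ℝ} (hl : 0 < l)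
    (hl1 : l ≤ 1) (hlS : l ∈ closure (S ∩ Set.Ioo 0 l)) (hα : 0 < α) (hα10 : α ≤ 1 / 10)
    (hαl : α ≤ mass S 0 l) (hu : u ∉ S) : u ≤ (1 - α) * (⌊1 / α⌋₊ : ℝ) := by
  rcases le_or_gt (α / l) (1 / 10) with h | h
  · have h1 : (1 : ℝ) ∈ closure ((fun x => l * x) ⁻¹' S ∩ Set.Ioo 0 1) := by
      rw [Metric.mem_closure_iff] at hlS ⊢
      intro ε hε
      obtain ⟨s, ⟨hs, hs0, hsl⟩, hd⟩ := hlS (l * ε) (by positivity)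
      refine ⟨s / l, ⟨?_, by positivity, (div_lt_one hl).2 hsl⟩, ?_⟩
      · rwa [Set.mem_preimage, mul_div_cancel₀ s hl.ne']
      · rw [Real.dist_eq, abs_of_pos (sub_pos.2 hsl)] at hd
        rw [Real.dist_eq, abs_of_pos (sub_pos.2 ((div_lt_one hl).2 hsl))]
        rw [show 1 - s / l = (l - s) / l by field_simp, div_lt_iff₀ hl]
        linarith
    have key := (hS.preimage_mul_left hl).le_one_sub_mul_floor h1 (α := α / l) (u := u / l)
      (by positivity) h
      (by rw [div_le_iff₀ hl, mul_comm, mul_mass_preimage_mul_left S hl]; exact hαl)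
      (by rwa [Set.mem_preimage, mul_div_cancel₀ u hl.ne'])
    rw [one_div_div] at key
    have hfl : (⌊l / α⌋₊ : ℝ) ≤ ⌊1 / α⌋₊ := by
      exact_mod_cast Nat.floor_le_floor (by gcongr)
    calc u = l * (u / l) := by field_simp
      _ ≤ l * ((1 - α / l) * ⌊l / α⌋₊) := by gcongr
      _ = (l - α) * ⌊l / α⌋₊ := by field_simp
      _ ≤ (1 - α) * ⌊1 / α⌋₊ := by gcongr; linarith
  · rw [lt_div_iff₀ hl] at h
    have hk : (10 : ℝ) ≤ ⌊1 / α⌋₊ := by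
      exact_mod_cast Nat.le_floor (n := 10) (by rw [le_div_iff₀ hα]; push_cast; linarith)
    have h9 : 9 ≤ (1 - α) * (⌊1 / α⌋₊ : ℝ) := by nlinarith
    rcases le_or_gt u 0 with hu0 | hu0
    · linarith
    obtain ⟨K, hK⟩ := hS.exists_le_nat_mul_sub hl hu hu0
    -- `K (19 - K) ≤ 90` for every integer `K`
    have hK90 : (K : ℝ) * (19 - K) ≤ 90 := by
      have : (K : ℤ) * (19 - K) ≤ 90 := by
        rcases le_or_gt (K : ℤ) 9 with h | h <;> nlinarith
      exact_mod_cast this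
    have h1 : (K : ℝ) * (2 * l - mass S 0 l * (K + 1)) ≤ K * (2 * (10 * α) - α * (K + 1)) := by
      gcongr
      linarith
    nlinarith

end IsOpenPosSemigroup

/-! ### The semigroup generated by an open set -/

lemma mem_sumSemigroup {A : Set ℝ} {u : ℝ} :
    u ∈ sumSemigroup A ↔ ∃ h : ℕ, 1 ≤ h ∧ u ∈ kFoldSum h A := by
  simp [sumSemigroup]

lemma subset_sumSemigroup (A : Set ℝ) : A ⊆ sumSemigroup A := fun a ha =>
  mem_sumSemigroup.2 ⟨1, le_rfl, fun _ => a, fun _ => ha, by simp⟩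

lemma add_mem_kFoldSum {A : Set ℝ} {m n : ℕ} {u v : ℝ} (hu : u ∈ kFoldSum m A)
    (hv : v ∈ kFoldSum n A) : u + v ∈ kFoldSum (m + n) A := by
  obtain ⟨a, ha, rfl⟩ := hu
  obtain ⟨b, hb, rfl⟩ := hv
  refine ⟨Fin.append a b, fun i => ?_, by simp [Fin.sum_univ_add]⟩
  refine Fin.addCases (fun i => ?_) (fun i => ?_) i
  · simpa using ha i
  · simpa using hb i

lemma isOpen_kFoldSum_succ {A : Set ℝ} (hA : IsOpen A) (h : ℕ) : IsOpen (kFoldSum (h + 1) A) := by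
  have : kFoldSum (h + 1) A = ⋃ b ∈ kFoldSum h A, (fun x => x - b) ⁻¹' A := by
    ext u
    simp only [Set.mem_iUnion, Set.mem_preimage, exists_prop]
    constructor
    · rintro ⟨a, ha, rfl⟩
      exact ⟨∑ i : Fin h, a i.succ, ⟨fun i => a i.succ, fun i => ha _, rfl⟩, by
        simpa [Fin.sum_univ_succ] using ha 0⟩
    · rintro ⟨b, ⟨a, ha, rfl⟩, hu⟩
      refine ⟨Fin.cons (u - ∑ i, a i) a, fun i => ?_, by simp [Fin.sum_univ_succ]⟩
      refine Fin.cases ?_ (fun i => ?_) i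
      · simpa using hu
      · simpa using ha i
  rw [this]
  exact isOpen_biUnion fun b _ => hA.preimage (by fun_prop)

lemma isOpenPosSemigroup_sumSemigroup {A : Set ℝ} (hA : IsOpen A) (hpos : ∀ a ∈ A, 0 < a) :
    IsOpenPosSemigroup (sumSemigroup A) where
  isOpen := isOpen_biUnion fun h hh => by
    obtain ⟨n, rfl⟩ := Nat.exists_eq_add_of_le' hh
    exact isOpen_kFoldSum_succ hA n
  pos := by
    intro s hs
    obtain ⟨h, hh, a, ha, rfl⟩ := mem_sumSemigroup.1 hs
    have : NeZero h := ⟨by omega⟩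
    exact Finset.sum_pos (fun i _ => hpos _ (ha i)) Finset.univ_nonempty
  add_mem := by
    intro s hs t ht
    obtain ⟨m, hm, hs⟩ := mem_sumSemigroup.1 hs
    obtain ⟨n, hn, ht⟩ := mem_sumSemigroup.1 ht
    exact mem_sumSemigroup.2 ⟨m + n, by omega, add_mem_kFoldSum hs ht⟩

/-! ### The bounds for `G(A)` -/

lemma natCast_floor_one_div {α : ℝ} (hα : 0 < α) : ((⌊1 / α⌋₊ : ℕ) : ℝ) = (⌊1 / α⌋ : ℝ) :=
  natCast_floor_eq_intCast_floor (by positivity)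

lemma floor_one_div_mul_le {α : ℝ} (hα : 0 < α) :
    (⌊1 / α⌋₊ : ℝ) * α ≤ 1 ∧ 1 < (⌊1 / α⌋₊ + 1 : ℝ) * α := by
  refine ⟨?_, ?_⟩
  · rw [← le_div_iff₀ hα]; exact Nat.floor_le (by positivity)
  · rw [← div_lt_iff₀ hα]; exact Nat.lt_floor_add_one _

/-- The quadratic `K (2 - α (K + 1))` is maximal, among the integers, at `K = ⌊1 / α⌋`. -/
lemma nat_mul_sub_le_floor {α : ℝ} (hα : 0 < α) (K : ℕ) :
    (K : ℝ) * (2 - α * (K + 1)) ≤ ⌊1 / α⌋₊ * (2 - α * (⌊1 / α⌋₊ + 1)) := by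
  obtain ⟨h1, h2⟩ := floor_one_div_mul_le hα
  set k := ⌊1 / α⌋₊
  rcases le_or_gt K k with h | h
  · obtain ⟨d, hd⟩ := Nat.exists_eq_add_of_le h
    have hd' : (k : ℝ) = K + d := by exact_mod_cast hd
    have hdd : (d : ℝ) ≤ d * d := by exact_mod_cast Nat.le_mul_self d
    have : 0 ≤ (d : ℝ) * (1 - k * α) := mul_nonneg (by positivity) (by linarith)
    have e : (K : ℝ) = k - d := by linarith
    rw [e]
    nlinarith
  · obtain ⟨d, hd⟩ := Nat.exists_eq_add_of_le (Nat.succ_le_of_lt h)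
    have e : (K : ℝ) = k + 1 + d := by
      have : K = k + 1 + d := hd
      exact_mod_cast this
    have : 0 ≤ ((d : ℝ) + 1) * ((k + 1) * α - 1) := mul_nonneg (by positivity) (by linarith)
    have : 0 ≤ (d : ℝ) * (d + 1) * α := by positivity
    rw [e]
    nlinarith

/-- The bounds for a single number `u` that is not a sum of elements of `A`. -/
lemma le_of_notMem_sumSemigroup {A : Set ℝ} {α u : ℝ} (hA : IsOpen A) (hA1 : A ⊆ Set.Ioo (0 : ℝ) 1)
    (hα : 0 < α) (hvol : volume A = ENNReal.ofReal α) (hu : u ∉ sumSemigroup A) :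
    (α ≤ 1 / 10 → u ≤ (1 - α) * (⌊1 / α⌋₊ : ℝ)) ∧
      (0 < u → ∃ K : ℕ, u ≤ K * (2 - α * (K + 1))) := by
  have hS := isOpenPosSemigroup_sumSemigroup hA fun a ha => (hA1 ha).1
  have hAS := subset_sumSemigroup A
  have hAα : volume.real A = α := by rw [measureReal_def, hvol, ENNReal.toReal_ofReal hα.le]
  have hmass : ∀ l, A ⊆ Set.Ioo 0 l → α ≤ mass (sumSemigroup A) 0 l := fun l hl => by
    rw [← hAα]
    exact measureReal_mono (Set.subset_inter hAS hl) (volume_inter_Ioo_ne_top _ _ _)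
  refine ⟨fun hα10 => ?_, fun hu0 => ?_⟩
  · have hne : A.Nonempty := by
      rw [Set.nonempty_iff_ne_empty]
      rintro rfl
      simp at hAα
      linarith
    have hbdd : BddAbove A := ⟨1, fun a ha => (hA1 ha).2.le⟩
    obtain ⟨l, hl⟩ : ∃ l, l = sSup A := ⟨_, rfl⟩
    have hle : ∀ a ∈ A, a ≤ l := fun a ha => hl ▸ le_csSup hbdd ha
    -- an open set does not contain its supremum
    have hlt : A ⊆ Set.Ioo 0 l := fun a ha => by
      refine ⟨(hA1 ha).1, lt_of_le_of_ne (hle a ha) ?_⟩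
      rintro rfl
      obtain ⟨ε, hε, hball⟩ := Metric.isOpen_iff.1 hA a ha
      have := hle (a + ε / 2) (hball (by
        rw [Metric.mem_ball, Real.dist_eq, add_sub_cancel_left, abs_of_pos] <;> linarith))
      linarith
    have hlS : l ∈ closure (sumSemigroup A ∩ Set.Ioo 0 l) :=
      closure_mono (Set.subset_inter hAS hlt) (hl ▸ csSup_mem_closure hne hbdd)
    have hl0 : 0 < l := by
      obtain ⟨a, ha⟩ := hne
      exact (hlt ha).1.trans (hlt ha).2
    exact hS.le_one_sub_mul_floor_of_le_one hl0
      (hl ▸ csSup_le hne fun a ha => (hA1 ha).2.le) hlS hα hα10 (hmass l hlt) hu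
  · obtain ⟨K, hK⟩ := hS.exists_le_nat_mul_sub one_pos hu hu0
    refine ⟨K, hK.trans ?_⟩
    have := hmass 1 hA1
    rw [mul_one]
    gcongr

lemma sub_add_mul_fract_mul_floor {α : ℝ} (hα : 0 < α) :
    (1 - α + α * Int.fract (1 / α)) * (⌊1 / α⌋ : ℝ) =
      ⌊1 / α⌋₊ * (2 - α * (⌊1 / α⌋₊ + 1)) := by
  rw [natCast_floor_one_div hα, Int.fract, mul_sub, mul_one_div_cancel hα.ne']
  ring

lemma nat_mul_sub_le_of_half_le {α : ℝ} (hα : 1 / 2 ≤ α) (hα1 : α ≤ 1) (K : ℕ) :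
    (K : ℝ) * (2 - α * (K + 1)) ≤ 2 * (1 - α) := by
  rcases K with _ | _ | K
  · simp; linarith
  · push_cast; linarith
  · push_cast
    have : 0 ≤ ((K : ℝ) + 1) * (α * (K + 4) - 2) :=
      mul_nonneg (by positivity) (by nlinarith [K.cast_nonneg (α := ℝ)])
    nlinarith

/-- The numbers that are not sums of elements of `A` have a largest element, which obeys the bounds
of the individual numbers. -/
lemma isGreatest_frobeniusG {A : Set ℝ} {α : ℝ} (hA : IsOpen A) (hA1 : A ⊆ Set.Ioo (0 : ℝ) 1)
    (hα : 0 < α) (hvol : volume A = ENNReal.ofReal α) :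
    IsGreatest {u : ℝ | u ∉ sumSemigroup A} (frobeniusG A) := by
  have hS := isOpenPosSemigroup_sumSemigroup hA fun a ha => (hA1 ha).1
  have hbdd : BddAbove {u : ℝ | u ∉ sumSemigroup A} := by
    refine ⟨max 0 (⌊1 / α⌋₊ * (2 - α * (⌊1 / α⌋₊ + 1))), fun u hu => ?_⟩
    rcases le_or_gt u 0 with h | h
    · exact h.trans (le_max_left _ _)
    · obtain ⟨K, hK⟩ := (le_of_notMem_sumSemigroup hA hA1 hα hvol hu).2 h
      exact (hK.trans (nat_mul_sub_le_floor hα K)).trans (le_max_right _ _)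
  refine ⟨?_, fun u hu => le_csSup hbdd hu⟩
  exact IsClosed.csSup_mem hS.isOpen.isClosed_compl ⟨0, fun h => (hS.pos 0 h).false⟩ hbdd

/-! ### The extremal sets -/

lemma mem_kFoldSum_Ioo {a b u : ℝ} {h : ℕ} (hh : 1 ≤ h) :
    u ∈ kFoldSum h (Set.Ioo a b) ↔ h * a < u ∧ u < h * b := by
  have h0 : (0 : ℝ) < h := by exact_mod_cast hh
  constructor
  · rintro ⟨x, hx, rfl⟩
    have : NeZero h := ⟨by omega⟩
    have e1 := Finset.sum_lt_sum_of_nonempty (Finset.univ_nonempty (α := Fin h))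
      fun i _ => (hx i).1
    have e2 := Finset.sum_lt_sum_of_nonempty (Finset.univ_nonempty (α := Fin h))
      fun i _ => (hx i).2
    simp only [Finset.sum_const, Finset.card_univ, Fintype.card_fin, nsmul_eq_mul] at e1 e2
    exact ⟨e1, e2⟩
  · rintro ⟨h1, h2⟩
    refine ⟨fun _ => u / h, fun _ => ⟨?_, ?_⟩, ?_⟩
    · rw [lt_div_iff₀ h0]; linarith
    · rw [div_lt_iff₀ h0]; linarith
    · simp [mul_div_cancel₀ u h0.ne']

lemma frobeniusG_Ioo {α : ℝ} (hα : 0 < α) (hα1 : α ≤ 1) :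
    frobeniusG (Set.Ioo (1 - α) 1) = (1 - α) * (⌊1 / α⌋ : ℝ) := by
  rw [← natCast_floor_one_div hα]
  obtain ⟨hk1, hk2⟩ := floor_one_div_mul_le hα
  set k := ⌊1 / α⌋₊
  refine IsGreatest.csSup_eq ⟨fun hmem => ?_, fun u hu => ?_⟩
  · obtain ⟨h, hh, hu⟩ := mem_sumSemigroup.1 hmem
    obtain ⟨h1, h2⟩ := (mem_kFoldSum_Ioo hh).1 hu
    have hhk : (h : ℝ) < k := by
      rw [mul_comm] at h1
      exact lt_of_mul_lt_mul_left h1 (by linarith)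
    have : (h : ℝ) + 1 ≤ k := by
      have : h < k := by exact_mod_cast hhk
      exact_mod_cast this
    linarith
  · by_contra! hlt
    have hk0 : (0 : ℝ) ≤ k := by positivity
    have hu0 : 0 ≤ u := (mul_nonneg (by linarith) hk0).trans hlt.le
    have hf1 := Nat.floor_le hu0
    have hf2 := Nat.lt_floor_add_one u
    refine hu (mem_sumSemigroup.2 ⟨⌊u⌋₊ + 1, by omega, (mem_kFoldSum_Ioo (by omega)).2 ⟨?_, ?_⟩⟩)
    · rcases le_or_gt (⌊u⌋₊ + 1) k with h | h
      · have h' : ((⌊u⌋₊ + 1 : ℕ) : ℝ) ≤ k := by exact_mod_cast h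
        have : ((⌊u⌋₊ + 1 : ℕ) : ℝ) * (1 - α) ≤ k * (1 - α) := by gcongr
        linarith
      · have h' : (k : ℝ) + 1 ≤ (⌊u⌋₊ + 1 : ℕ) := by exact_mod_cast h
        have : ((k : ℝ) + 1) * α ≤ (⌊u⌋₊ + 1 : ℕ) * α := by gcongr
        push_cast at this ⊢
        linarith
    · push_cast; linarith

lemma volume_Ioo_one_sub (α : ℝ) : volume (Set.Ioo (1 - α) 1) = ENNReal.ofReal α := by
  rw [Real.volume_Ioo, sub_sub_cancel]

/-- A sum of at least two elements exceeds `2 (1 - α)`. -/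
lemma two_mul_one_sub_notMem_sumSemigroup {α : ℝ} (hα1 : α ≤ 1) :
    2 * (1 - α) ∉ sumSemigroup (Set.Ioo (1 - α) 1 \ {2 * (1 - α)}) := by
  intro hmem
  obtain ⟨h, hh, a, ha, hsum⟩ := mem_sumSemigroup.1 hmem
  rcases hh.eq_or_lt with rfl | hh2
  · rw [Fin.sum_univ_one] at hsum
    exact (ha 0).2 hsum
  · have := ((mem_kFoldSum_Ioo (a := 1 - α) (b := 1) (by omega)).1
      ⟨a, fun i => (ha i).1, hsum⟩).1
    have h2 : (2 : ℝ) ≤ h := by exact_mod_cast hh2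
    nlinarith

theorem mainTheorem1 :
    -- the upper bounds; `frobeniusG A` is a genuine (attained) supremum
    (∀ (A : Set ℝ) (α : ℝ), IsOpen A → A ⊆ Set.Ioo (0 : ℝ) 1 → 0 < α → α ≤ 1 →
      volume A = ENNReal.ofReal α →
        IsGreatest {u : ℝ | u ∉ sumSemigroup A} (frobeniusG A) ∧
        (α ≤ 1 / 10 → frobeniusG A ≤ (1 - α) * (⌊1 / α⌋ : ℝ)) ∧
        (1 / 10 ≤ α → α ≤ 1 / 2 →
          frobeniusG A ≤ (1 - α + α * Int.fract (1 / α)) * (⌊1 / α⌋ : ℝ)) ∧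
        (1 / 2 ≤ α → frobeniusG A ≤ 2 * (1 - α))) ∧
    -- the interval `(1 - α, 1)`, which attains the first bound
    (∀ α : ℝ, 0 < α → α ≤ 1 →
      IsOpen (Set.Ioo (1 - α) 1) ∧ Set.Ioo (1 - α) 1 ⊆ Set.Ioo (0 : ℝ) 1 ∧
      volume (Set.Ioo (1 - α) 1) = ENNReal.ofReal α ∧
      frobeniusG (Set.Ioo (1 - α) 1) = (1 - α) * (⌊1 / α⌋ : ℝ)) ∧
    -- the punctured interval `(1 - α, 1) ∖ {2 (1 - α)}`, which attains the third bound
    (∀ α : ℝ, 1 / 2 ≤ α → α ≤ 1 →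
      IsOpen (Set.Ioo (1 - α) 1 \ {2 * (1 - α)}) ∧
      Set.Ioo (1 - α) 1 \ {2 * (1 - α)} ⊆ Set.Ioo (0 : ℝ) 1 ∧
      volume (Set.Ioo (1 - α) 1 \ {2 * (1 - α)}) = ENNReal.ofReal α ∧
      frobeniusG (Set.Ioo (1 - α) 1 \ {2 * (1 - α)}) = 2 * (1 - α)) := by
  have third : ∀ (A : Set ℝ) (α : ℝ), IsOpen A → A ⊆ Set.Ioo (0 : ℝ) 1 → 0 < α → α ≤ 1 →
      volume A = ENNReal.ofReal α → 1 / 2 ≤ α → frobeniusG A ≤ 2 * (1 - α) := by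
    intro A α hA hA1 hα hα1 hvol h2
    have hG := (isGreatest_frobeniusG hA hA1 hα hvol).1
    rcases le_or_gt (frobeniusG A) 0 with h0 | h0
    · linarith
    obtain ⟨K, hK⟩ := (le_of_notMem_sumSemigroup hA hA1 hα hvol hG).2 h0
    exact hK.trans (nat_mul_sub_le_of_half_le h2 hα1 K)
  refine ⟨fun A α hA hA1 hα hα1 hvol => ?_, fun α hα hα1 => ?_, fun α h2 hα1 => ?_⟩
  · have hG := isGreatest_frobeniusG hA hA1 hα hvol
    have hle := le_of_notMem_sumSemigroup hA hA1 hα hvol hG.1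
    refine ⟨hG, fun h => ?_, fun _ _ => ?_, third A α hA hA1 hα hα1 hvol⟩
    · rw [← natCast_floor_one_div hα]
      exact hle.1 h
    · rw [sub_add_mul_fract_mul_floor hα]
      rcases le_or_gt (frobeniusG A) 0 with h0 | h0
      · simpa using h0.trans (by simpa using nat_mul_sub_le_floor hα 0)
      obtain ⟨K, hK⟩ := hle.2 h0
      exact hK.trans (nat_mul_sub_le_floor hα K)
  · exact ⟨isOpen_Ioo, Set.Ioo_subset_Ioo_left (by linarith), volume_Ioo_one_sub α,
      frobeniusG_Ioo hα hα1⟩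
  · have hα : 0 < α := by linarith
    have hA : IsOpen (Set.Ioo (1 - α) 1 \ {2 * (1 - α)}) := isOpen_Ioo.sdiff isClosed_singleton
    have hA1 : Set.Ioo (1 - α) 1 \ {2 * (1 - α)} ⊆ Set.Ioo (0 : ℝ) 1 :=
      Set.sdiff_subset.trans (Set.Ioo_subset_Ioo_left (by linarith))
    have hvol : volume (Set.Ioo (1 - α) 1 \ {2 * (1 - α)}) = ENNReal.ofReal α := by
      rw [measure_sdiff_null (by simp), volume_Ioo_one_sub]
    exact ⟨hA, hA1, hvol, le_antisymm (third _ α hA hA1 hα hα1 hvol h2)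
      ((isGreatest_frobeniusG hA hA1 hα hvol).2 (two_mul_one_sub_notMem_sumSemigroup hα1))⟩
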